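/- Conventions. An operator system is a norm-closed complex linear subspace $E \subseteq B(H)$ of the bounded operators on a complex Hilbert space $H$ with $x^* \in E$ for all $x \in E$ (it need not contain the unit). The space $M_n(E)$ carries the norm and the positive cone $M_n(E)_+$ inherited from $M_n(B(H)) = B(H^n)$; a C*-algebra $A$ (unital or not) carries those of the C*-algebras $M_n(A)$. The canonical unitization of $E$ is the space $E^\sharp = E \oplus \mathbb{C}$ with unit $(0,1)$ and involution $(x,\lambda)^* = (x^*, \overline{\lambda})$, where $(X,A) \in M_n(E) \oplus M_n(\mathbb{C}) = M_n(E^\sharp)$ is positive if and only if $X = X^*$, $A \geq 0$, and $$\varphi\big(A_\varepsilon^{-1/2} X A_\varepsilon^{-1/2}\big) \geq -1, \qquad A_\varepsilon = \varepsilon 1 + A,$$ for all $\varepsilon > 0$ and all self-adjoint, positive, contractive linear functionals $\varphi : M_n(E) \to \mathbb{C}$; its matrix norms are the order unit norms $$\|Z\| = \inf\left\{ t \geq 0 : \begin{pmatrix} t1 & Z \\ Z^* & t1 \end{pmatrix} \in M_{2n}(E^\sharp)_+ \right\}.$$ Such a space is isomorphic to a C*-algebra if there are a C*-algebra $A$ and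 a $*$-preserving linear bijection onto $A$ that is completely isometric and a complete order isomorphism (it preserves positivity of matrices in both directions at every matrix level). Corollary B. Let $E$ be an operator system. Suppose that there are a family of C*-algebras $(\mathcal{M}_i)_i$ and positive linear maps $\rho_i : \mathcal{M}_i \to E$ such that $E = \overline{\bigcup_i \rho_i(\mathcal{M}_i)}$ (norm closure). Then the following are equivalent: (1) $E$ is isomorphic to a C*-algebra. (2) The canonical unitization $E^\sharp$ is isomorphic to a C*-algebra. -/

import Mathlib

universe u v w

/-- An operator system on the Hilbert space `H` (not necessarily unital): a norm-closed complex
linear subspace of `B(H)` that is closed under the involution. -/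
structure OperatorSystem (H : Type u) [NormedAddCommGroup H] [InnerProductSpace ℂ H]
    [CompleteSpace H] extends Submodule ℂ (H →L[ℂ] H) where
  star_mem' : ∀ {x : H →L[ℂ] H}, x ∈ carrier → star x ∈ carrier
  isClosed' : IsClosed carrier

namespace OperatorSystem

variable {H : Type u} [NormedAddCommGroup H] [InnerProductSpace ℂ H] [CompleteSpace H]

instance : SetLike (OperatorSystem H) (H →L[ℂ] H) where
  coe E := E.carrier
  coe_injective E F h := by
    obtain ⟨E, _, _⟩ := E
    obtain ⟨F, _, _⟩ := F
    congr
    exact SetLike.coe_injective h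

instance : AddSubgroupClass (OperatorSystem H) (H →L[ℂ] H) where
  add_mem {E} _ _ hx hy := E.toSubmodule.add_mem hx hy
  zero_mem E := E.toSubmodule.zero_mem
  neg_mem {E} _ hx := E.toSubmodule.neg_mem hx

instance : SMulMemClass (OperatorSystem H) ℂ (H →L[ℂ] H) where
  smul_mem {E} c _ hx := E.toSubmodule.smul_mem c hx

instance : StarMemClass (OperatorSystem H) (H →L[ℂ] H) where
  star_mem {E} _ hx := E.star_mem' hx

end OperatorSystem

/-- The data of a norm and of a set of positive elements on every matrix space `M_n(V)`, with
matrices indexed by arbitrary finite types `n`. It only serves to record these data for the concrete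
spaces below. -/
structure MatrixNormOrder (V : Type u) where
  /-- the norm on `M_n(V)` -/
  norm : ∀ (n : Type) [Fintype n] [DecidableEq n], Matrix n n V → ℝ
  /-- the positive elements of `M_n(V)` -/
  pos : ∀ (n : Type) [Fintype n] [DecidableEq n], Set (Matrix n n V)

/-- The matrix norms and matrix cones of a C⋆-algebra `A`: those of the C⋆-algebras `M_n(A)`. -/
noncomputable def cstarMatrixNormOrder (A : Type u) [NonUnitalCStarAlgebra A] [PartialOrder A]
    [StarOrderedRing A] : MatrixNormOrder A where
  norm _ _ _ X := ‖CStarMatrix.ofMatrix X‖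
  pos _ _ _ := {X | 0 ≤ CStarMatrix.ofMatrix X}

/-- The matrix norms and matrix cones of an operator system `E ⊆ B(H)`: those inherited from
`M_n(E) ⊆ M_n(B(H))`. -/
noncomputable def OperatorSystem.matrixNormOrder {H : Type u} [NormedAddCommGroup H]
    [InnerProductSpace ℂ H] [CompleteSpace H] (E : OperatorSystem H) : MatrixNormOrder E where
  norm n _ _ X := (cstarMatrixNormOrder (H →L[ℂ] H)).norm n (X.map Subtype.val)
  pos n _ _ := {X | X.map Subtype.val ∈ (cstarMatrixNormOrder (H →L[ℂ] H)).pos n}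

section Unitization

variable {V : Type u} [AddCommGroup V] [Module ℂ V] [Star V]

/-- A quasistate on `M_n(V)`: a self-adjoint, positive, contractive linear functional. -/
def MatrixNormOrder.IsQuasistate (S : MatrixNormOrder V) {n : Type} [Fintype n] [DecidableEq n]
    (φ : Matrix n n V →ₗ[ℂ] ℂ) : Prop :=
  (∀ X : Matrix n n V, φ X.conjTranspose = star (φ X)) ∧
  (∀ X ∈ S.pos n, 0 ≤ (φ X).re) ∧
  (∀ X : Matrix n n V, ‖φ X‖ ≤ S.norm n X)

/-- The product `B X B`, where `B` is a scalar matrix and `X` a matrix over `V`. -/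
def scalarCompress {n : Type} [Fintype n] (B : Matrix n n ℂ) (X : Matrix n n V) : Matrix n n V :=
  Matrix.of fun i j => ∑ k, ∑ l, (B i k * B l j) • X k l

open scoped ComplexOrder MatrixOrder in
/-- The matrix `A_ε ^ (-1/2)`, where `A_ε = ε 1 + A`. -/
noncomputable def invSqrtShift {n : Type} [Fintype n] [DecidableEq n] (A : Matrix n n ℂ) (ε : ℝ) :
    Matrix n n ℂ :=
  (CFC.sqrt ((ε : ℂ) • (1 : Matrix n n ℂ) + A))⁻¹

open scoped ComplexOrder in
/-- The positive elements of `M_n(V^♯)`, `V^♯ = V ⊕ ℂ`. An element is a pair `(X, A)` of a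
self-adjoint matrix `X` over `V` and a scalar matrix `A`; it is positive if `A ≥ 0` and
`φ (A_ε ^ (-1/2) X A_ε ^ (-1/2)) ≥ -1` for all `ε > 0` and all quasistates `φ` on `M_n(V)`. -/
def MatrixNormOrder.sharpPos (S : MatrixNormOrder V) (n : Type) [Fintype n] [DecidableEq n] :
    Set (Matrix n n (Unitization ℂ V)) :=
  {Z | (Z.map fun z => z.snd).IsHermitian ∧ (Z.map fun z => z.fst).PosSemidef ∧
    ∀ ε : ℝ, 0 < ε → ∀ φ : Matrix n n V →ₗ[ℂ] ℂ, S.IsQuasistate φ →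
      -1 ≤ (φ (scalarCompress (invSqrtShift (Z.map fun z => z.fst) ε)
        (Z.map fun z => z.snd))).re}

/-- The scalar matrix `t 1` in `M_n(V^♯)`, the unit of `V^♯` being `(0, 1)`. -/
def sharpScalar (n : Type) [DecidableEq n] (t : ℝ) : Matrix n n (Unitization ℂ V) :=
  Matrix.diagonal fun _ => Unitization.inl (t : ℂ)

/-- The canonical unitization `V^♯ = V ⊕ ℂ`. Its matrix norms are the order unit norms:
`‖Z‖` is the least `t ≥ 0` for which the block matrix with rows `(t 1, Z)`, `(Z⋆, t 1)` is
positive. -/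
noncomputable def MatrixNormOrder.sharp (S : MatrixNormOrder V) :
    MatrixNormOrder (Unitization ℂ V) where
  norm n _ _ Z := sInf {t : ℝ | 0 ≤ t ∧
    Matrix.fromBlocks (sharpScalar n t) Z Z.conjTranspose (sharpScalar n t) ∈ S.sharpPos (n ⊕ n)}
  pos n _ _ := S.sharpPos n

/-- An isomorphism of operator systems: a linear bijection that preserves the involution, the norm
of all matrices, and positivity of all matrices in both directions (a completely isometric complete
order isomorphism). -/
structure MatrixNormOrder.Iso {W : Type v} [AddCommGroup W] [Module ℂ W] [Star W]
    (S : MatrixNormOrder V) (T : MatrixNormOrder W) where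
  toLinearEquiv : V ≃ₗ[ℂ] W
  map_star : ∀ x, toLinearEquiv (star x) = star (toLinearEquiv x)
  norm_map : ∀ (n : Type) [Fintype n] [DecidableEq n] (X : Matrix n n V),
    T.norm n (X.map toLinearEquiv) = S.norm n X
  map_mem_pos_iff : ∀ (n : Type) [Fintype n] [DecidableEq n] (X : Matrix n n V),
    X.map toLinearEquiv ∈ T.pos n ↔ X ∈ S.pos n

/-- The space `V` with the given matrix norms and cones is isomorphic to a (possibly non-unital)
C⋆-algebra. -/
def MatrixNormOrder.IsIsomorphicToCStarAlgebra (S : MatrixNormOrder V) : Prop :=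
  ∃ (A : Type u) (_ : NonUnitalCStarAlgebra A) (_ : PartialOrder A) (_ : StarOrderedRing A),
    Nonempty (S.Iso (cstarMatrixNormOrder A))

end Unitization

/-! (1) ⇒ (2): if `E` is a C⋆-algebra `A`, then `E^♯` is the C⋆-unitization of `A`. Writing an
element of `M_n` of the unitization as `N = A + X` with scalar part `A ≥ 0`, conjugation of `ε + N`
by `A_ε^{-1/2}` gives `1 + A_ε^{-1/2} X A_ε^{-1/2}`. Positivity of `1 + Y` is the same as `φ(Y) ≥
-1` for all quasistates `φ`: states restrict to quasistates (`nonneg_of_forall_isQuasistate`), and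
`1 + Y ≥ 0` forces `‖Y⁻‖ ≤ 1` (`neg_one_le_quasistate`).

(2) ⇒ (1): let `C` be a C⋆-algebra isomorphic to `E^♯`. The scalar coordinate is a positive
functional `χ` on `C` whose kernel is the image of `E`. For positive `h` in the kernel,
Cauchy-Schwarz gives `χ(h y) = 0` for every `y` (`apply_mul_eq_zero`). The maps `ρ_i` make the span
of such `h` dense in the image of `E`, so that image is closed under products, hence a C⋆-subalgebra
of `C`. Its matrix norms and cones are those of `E`, because a concrete operator system embeds in
`E^♯` completely isometrically and as an ordered space. -/

/-! ### States on unital C⋆-algebras. -/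

section States

variable {B : Type*} [CStarAlgebra B] [PartialOrder B] [StarOrderedRing B]

-- Cauchy-Schwarz for the GNS form: `ψ x = ⟨1, x⟩`, where `‖1‖ ≤ 1` and `ψ (x⋆ x) ≤ ‖x‖²`.
open scoped ComplexOrder in
lemma PositiveLinearMap.norm_apply_le_norm (ψ : B →ₚ[ℂ] ℂ) (h1 : ψ 1 = 1) (x : B) :
    ‖ψ x‖ ≤ ‖x‖ := by
  have key : ∀ y : B, ‖ψ.toPreGNS y‖ ≤ ‖y‖ := fun y => by
    rw [ψ.preGNS_norm_def]
    refine Real.sqrt_le_iff.2 ⟨norm_nonneg _, ?_⟩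
    calc (ψ (star y * y)).re ≤ ‖ψ (star y * y)‖ := Complex.re_le_norm _
      _ ≤ ‖ψ 1‖ * ‖star y * y‖ := ψ.norm_apply_le_of_nonneg _ (star_mul_self_nonneg y)
      _ = ‖y‖ ^ 2 := by rw [h1, CStarRing.norm_star_mul_self]; simp [sq]
  have h1' : ‖ψ.toPreGNS 1‖ ≤ 1 := by
    rw [ψ.preGNS_norm_def]
    simp [h1]
  calc ‖ψ x‖ = ‖inner ℂ (ψ.toPreGNS 1) (ψ.toPreGNS x)‖ := by simp [ψ.preGNS_inner_def]
    _ ≤ ‖ψ.toPreGNS 1‖ * ‖ψ.toPreGNS x‖ := norm_inner_le_norm _ _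
    _ ≤ 1 * ‖x‖ := by gcongr; exact key x
    _ = ‖x‖ := one_mul _

open scoped ComplexOrder in
lemma PositiveLinearMap.apply_star (ψ : B →ₚ[ℂ] ℂ) (x : B) : ψ (star x) = star (ψ x) :=
  map_star ψ x

lemma nonneg_smul_of_nonneg {D : Type*} [NonUnitalCStarAlgebra D] [PartialOrder D]
    [StarOrderedRing D] {a : D} (ha : 0 ≤ a) {r : ℝ} (hr : 0 ≤ r) : 0 ≤ (r : ℂ) • a := by
  rw [Complex.coe_smul]; exact smul_nonneg hr ha

-- Hahn-Banach separates `b` from the closed convex cone of positive elements; the separating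
-- functional is then made self-adjoint and normalized.
open scoped ComplexOrder in
lemma exists_state_re_apply_neg {b : B} (hb : IsSelfAdjoint b) (hn : ¬ 0 ≤ b) :
    ∃ ψ : B →ₚ[ℂ] ℂ, ψ 1 = 1 ∧ (ψ b).re < 0 := by
  have hconv : Convex ℝ {a : B | 0 ≤ a} := by
    intro x hx y hy s t hs ht _
    exact add_nonneg (smul_nonneg hs hx) (smul_nonneg ht hy)
  obtain ⟨f, u, hfb, hu⟩ := RCLike.geometric_hahn_banach_point_closed (𝕜 := ℂ) hconv
    CStarAlgebra.isClosed_nonneg hn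
  have hu0 : u < 0 := by simpa using hu 0 (le_refl (0 : B))
  -- If `Re f a < 0`, the multiple of `a` on which `Re f` equals `u` still lies in the cone, against
  -- the strict separation.
  have hf : ∀ a : B, 0 ≤ a → 0 ≤ (f a).re := fun a ha => by
    by_contra! hlt
    have h := hu (((u / (f a).re : ℝ) : ℂ) • a)
      (nonneg_smul_of_nonneg ha (div_nonneg_of_nonpos hu0.le hlt.le))
    simp only [map_smul, smul_eq_mul, RCLike.re_to_complex, Complex.re_ofReal_mul] at h
    rw [div_mul_cancel₀ _ hlt.ne] at h
    exact lt_irrefl _ h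
  -- The self-adjoint part of `f`: separation controls only real parts, and `g` agrees with `Re f`
  -- on self-adjoint elements.
  let g : B →ₗ[ℂ] ℂ :=
    { toFun := fun x => (f x + star (f (star x))) / 2
      map_add' := fun x y => by simp; ring
      map_smul' := fun c x => by simp; ring }
  have hg : ∀ x, IsSelfAdjoint x → g x = ((f x).re : ℂ) := fun x hx => by
    change (f x + star (f (star x))) / 2 = _
    rw [hx.star_eq, Complex.star_def, Complex.add_conj]
    push_cast; ring
  have hgpos : ∀ x : B, 0 ≤ x → 0 ≤ g x := fun x hx => by
    rw [hg x (.of_nonneg hx)]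
    exact_mod_cast hf x hx
  let ψ₀ : B →ₚ[ℂ] ℂ := .mk₀ g hgpos
  have hψ₀ : ∀ x, ψ₀ x = g x := fun _ => rfl
  set r : ℝ := (f 1).re with hr
  have hg1 : g 1 = (r : ℂ) := hg 1 (.one B)
  have hbr : (f b).re < 0 := hfb.trans hu0
  -- Were `g 1 = 0`, the bound `-b ≤ ‖b‖ 1` would give `-g b ≤ 0`.
  have hrpos : 0 < r := by
    refine lt_of_le_of_ne (hf 1 zero_le_one) fun h0 => ?_
    have h2 := ψ₀.apply_le_of_isSelfAdjoint (-b) hb.neg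
    rw [Algebra.algebraMap_eq_smul_one, ← Complex.coe_smul, map_smul, hψ₀, hψ₀, map_neg, hg1,
      ← h0, hg b hb] at h2
    simp only [Complex.ofReal_zero, smul_zero] at h2
    rw [← Complex.ofReal_neg] at h2
    have : -(f b).re ≤ 0 := by exact_mod_cast h2
    linarith
  refine ⟨.mk₀ (((r⁻¹ : ℝ) : ℂ) • g) fun x hx => ?_, ?_, ?_⟩
  · have : (0 : ℂ) ≤ ((r⁻¹ : ℝ) : ℂ) := by exact_mod_cast (inv_nonneg.2 hrpos.le)
    simpa using mul_nonneg this (hgpos x hx)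
  · change ((r⁻¹ : ℝ) : ℂ) • g 1 = 1
    rw [hg1, smul_eq_mul, ← Complex.ofReal_mul, inv_mul_cancel₀ hrpos.ne', Complex.ofReal_one]
  · change (((r⁻¹ : ℝ) : ℂ) • g b).re < 0
    rw [hg b hb, smul_eq_mul, ← Complex.ofReal_mul, Complex.ofReal_re]
    exact mul_neg_of_pos_of_neg (inv_pos.2 hrpos) hbr

end States

/-! ### Positivity under injective star-homomorphisms, and negative parts. -/

section StarHom

variable {D : Type*} [NonUnitalCStarAlgebra D] [PartialOrder D] [StarOrderedRing D]

/-- By uniqueness of the Jordan decomposition, `f a⁻` is the negative part of `f a`. -/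
lemma NonUnitalStarAlgHom.map_nonneg_iff {F : Type*} [NonUnitalCStarAlgebra F] [PartialOrder F]
    [StarOrderedRing F] {Φ : Type*} [FunLike Φ D F] [NonUnitalAlgHomClass Φ ℂ D F]
    [StarHomClass Φ D F] (f : Φ) (hf : Function.Injective f) {a : D} :
    0 ≤ f a ↔ 0 ≤ a := by
  refine ⟨fun h => ?_, fun h => map_nonneg f h⟩
  have hsa : IsSelfAdjoint a := hf (by rw [map_star, (IsSelfAdjoint.of_nonneg h).star_eq])
  have h1 : f a = f a⁺ - f a⁻ := by rw [← map_sub, CFC.posPart_sub_negPart a]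
  have h2 := (CFC.posPart_negPart_unique h1 (by rw [← map_mul]; simp)
    (map_nonneg f (CFC.posPart_nonneg a)) (map_nonneg f (CFC.negPart_nonneg a))).2
  rw [(CFC.negPart_eq_zero_iff (f a)).2 h] at h2
  exact (CFC.negPart_eq_zero_iff a).1 (hf (by rw [← h2, map_zero]))

variable {B : Type*} [CStarAlgebra B] [PartialOrder B] [StarOrderedRing B]

/-- Compressing `f y + 1 ≥ 0` by `p = f y⁻` gives `p³ ≤ p²`. Then `‖p‖⁴ = ‖p⁴‖ ≤ ‖p³‖ ‖p‖ ≤ ‖p‖³`.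
The unit is needed only in `B`, so `D` may be non-unital. -/
lemma norm_negPart_le_one (f : D →⋆ₙₐ[ℂ] B) (hf : Function.Injective f) {y : D}
    (hy : IsSelfAdjoint y) (h : 0 ≤ f y + 1) : ‖y⁻‖ ≤ 1 := by
  rw [← NonUnitalStarAlgHom.norm_map f hf]
  set p := f y⁻ with hp
  have hpn : 0 ≤ p := map_nonneg f (CFC.negPart_nonneg y)
  have hps : IsSelfAdjoint p := .of_nonneg hpn
  have h1 : p * f y * p = - (p * p * p) := by
    rw [← CFC.posPart_sub_negPart y, map_sub, mul_sub, ← map_mul]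
    simp [hp]
  have h2 : p * p * p ≤ p * p := by
    have := star_left_conjugate_nonneg h p
    rw [hps.star_eq, mul_add, add_mul, h1, mul_one] at this
    rwa [← sub_nonneg, sub_eq_neg_add]
  have hppp : 0 ≤ p * p * p := by
    simpa [hps.star_eq] using star_left_conjugate_nonneg hpn p
  have h3 : ‖p * p * p‖ ≤ ‖p * p‖ := CStarAlgebra.norm_le_norm_of_nonneg_of_le hppp h2
  have h4 : ‖p * p‖ = ‖p‖ * ‖p‖ := by
    have := CStarRing.norm_star_mul_self (x := p)
    rwa [hps.star_eq] at this
  have h5 : ‖(p * p) * (p * p)‖ = ‖p * p‖ * ‖p * p‖ := by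
    have := CStarRing.norm_star_mul_self (x := p * p)
    rwa [star_mul, hps.star_eq] at this
  have h6 : ‖(p * p) * (p * p)‖ ≤ ‖p * p * p‖ * ‖p‖ := by
    rw [← mul_assoc]; exact norm_mul_le _ _
  rw [h5, h4] at h6
  rw [h4] at h3
  by_contra! hlt
  have h0 : 0 < ‖p‖ := by linarith
  have h7 : ‖p * p * p‖ * ‖p‖ ≤ ‖p‖ * ‖p‖ * ‖p‖ := by gcongr
  have h8 : ‖p‖ * ‖p‖ * ‖p‖ < ‖p‖ * ‖p‖ * (‖p‖ * ‖p‖) := by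
    rw [← mul_assoc]; exact lt_mul_of_one_lt_right (by positivity) hlt
  linarith

lemma exists_eq_sub_of_nonneg_add_one (f : D →⋆ₙₐ[ℂ] B) (hf : Function.Injective f) {y : D}
    (h : 0 ≤ f y + 1) : ∃ p m : D, 0 ≤ p ∧ 0 ≤ m ∧ ‖m‖ ≤ 1 ∧ y = p - m := by
  have hy : IsSelfAdjoint y := by
    refine hf ?_
    rw [map_star]
    have h1 := (IsSelfAdjoint.of_nonneg h).sub (.one _)
    rwa [add_sub_cancel_right] at h1
  exact ⟨y⁺, y⁻, CFC.posPart_nonneg y, CFC.negPart_nonneg y, norm_negPart_le_one f hf hy h,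
    (CFC.posPart_sub_negPart y).symm⟩

end StarHom

lemma IsSelfAdjoint.norm_le_of_mem_Icc {B : Type*} [CStarAlgebra B] [PartialOrder B]
    [StarOrderedRing B] {a : B} (ha : IsSelfAdjoint a) {t : ℝ} (ht : 0 ≤ t)
    (h1 : a ≤ algebraMap ℝ B t) (h2 : -a ≤ algebraMap ℝ B t) : ‖a‖ ≤ t := by
  cases subsingleton_or_nontrivial B
  · rwa [Subsingleton.elim a 0, norm_zero]
  rw [le_algebraMap_iff_spectrum_le] at h1 h2
  rcases CStarAlgebra.norm_or_neg_norm_mem_spectrum ha with h | h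
  · exact h1 _ h
  · exact h2 _ (by rw [← spectrum.neg_eq]; simpa using h)

/-! ### Off-diagonal block matrices and the order unit norm. -/

namespace CStarMatrix

section

variable {n : Type*} {A : Type*} [NonUnitalCStarAlgebra A]

/-- The self-adjoint block matrix with off-diagonal corners `X` and `X⋆`. -/
def offDiagonal (X : CStarMatrix n n A) : CStarMatrix (n ⊕ n) (n ⊕ n) A :=
  ofMatrix (Matrix.fromBlocks 0 (ofMatrix.symm X) (ofMatrix.symm (star X)) 0)

lemma isSelfAdjoint_offDiagonal (X : CStarMatrix n n A) : IsSelfAdjoint (offDiagonal X) := by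
  ext i j; rcases i with i | i <;> rcases j with j | j <;> simp [star_apply, offDiagonal]

variable [Fintype n]

/-- The block diagonal embedding of pairs of matrices. -/
def blockDiagonalHom (n : Type*) [Fintype n] (A : Type*) [NonUnitalCStarAlgebra A] :
    CStarMatrix n n A × CStarMatrix n n A →⋆ₙₐ[ℂ] CStarMatrix (n ⊕ n) (n ⊕ n) A where
  toFun p := ofMatrix (Matrix.fromBlocks (ofMatrix.symm p.1) 0 0 (ofMatrix.symm p.2))
  map_smul' c p := by
    ext i j; rcases i with i | i <;> rcases j with j | j <;> simp
  map_zero' := by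
    ext i j; rcases i with i | i <;> rcases j with j | j <;> simp
  map_add' p q := by
    ext i j; rcases i with i | i <;> rcases j with j | j <;> simp
  map_mul' p q := by
    ext i j; rcases i with i | i <;> rcases j with j | j <;>
      simp [mul_apply]
  map_star' p := by
    ext i j; rcases i with i | i <;> rcases j with j | j <;> simp [star_apply]

lemma blockDiagonalHom_injective : Function.Injective (blockDiagonalHom n A) := by
  intro p q h
  have h' : Matrix.fromBlocks _ _ _ _ = Matrix.fromBlocks _ _ _ _ := h
  obtain ⟨h1, -, -, h2⟩ := Matrix.fromBlocks_inj.1 h'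
  exact Prod.ext h1 h2

lemma offDiagonal_mul_self (X : CStarMatrix n n A) :
    offDiagonal X * offDiagonal X = blockDiagonalHom n A (X * star X, star X * X) := by
  ext i j; rcases i with i | i <;> rcases j with j | j <;>
    simp [mul_apply, offDiagonal, blockDiagonalHom]

variable [PartialOrder A] [StarOrderedRing A]

/-- The square is block diagonal with entries `X X⋆` and `X⋆ X`, and the block diagonal embedding is
isometric. -/
lemma norm_offDiagonal (X : CStarMatrix n n A) : ‖offDiagonal X‖ = ‖X‖ := by
  have h := CStarRing.norm_star_mul_self (x := offDiagonal X)
  rw [(isSelfAdjoint_offDiagonal X).star_eq, offDiagonal_mul_self,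
    NonUnitalStarAlgHom.norm_map (blockDiagonalHom n A) blockDiagonalHom_injective, Prod.norm_def,
    CStarRing.norm_star_mul_self, CStarRing.norm_self_mul_star, max_self] at h
  exact (mul_self_inj (norm_nonneg _) (norm_nonneg _)).1 h.symm

end

section

variable {n : Type*} [Fintype n] [DecidableEq n] {B : Type*} [CStarAlgebra B] [PartialOrder B] [StarOrderedRing B]

lemma nonneg_add_offDiagonal_iff (X : CStarMatrix n n B) {t : ℝ} (ht : 0 ≤ t) :
    0 ≤ (t : ℂ) • (1 : CStarMatrix (n ⊕ n) (n ⊕ n) B) + offDiagonal X ↔ ‖X‖ ≤ t := by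
  have hW := isSelfAdjoint_offDiagonal X
  rw [← norm_offDiagonal]
  have e : (t : ℂ) • (1 : CStarMatrix (n ⊕ n) (n ⊕ n) B) = algebraMap ℝ _ t := by
    rw [Algebra.algebraMap_eq_smul_one, Complex.coe_smul]
    rfl
  rw [e]
  constructor
  · intro h
    have h2 : -offDiagonal X ≤ algebraMap ℝ _ t := by
      rwa [neg_le_iff_add_nonneg]
    refine hW.norm_le_of_mem_Icc ht ?_ h2
    -- Conjugation by the symmetry `diag(1, -1)` changes the sign of the off-diagonal matrix, so the
    -- one-sided bound gives the other.
    let u : CStarMatrix (n ⊕ n) (n ⊕ n) B := blockDiagonalHom n B (1, -1)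
    have hu : star u = u := by
      rw [← map_star, Prod.star_def]; simp [u]
    have h3 := star_left_conjugate_nonneg h u
    have hu2 : u * u = 1 := by
      rw [← map_mul]
      ext i j; rcases i with i | i <;> rcases j with j | j <;>
        simp [blockDiagonalHom, one_apply]
    have h4 : u * offDiagonal X * u = - offDiagonal X := by
      ext i j; rcases i with i | i <;> rcases j with j | j <;>
        simp [mul_apply, offDiagonal, u, blockDiagonalHom, one_apply]
    rw [hu, mul_add, add_mul, h4, Algebra.algebraMap_eq_smul_one, mul_smul_comm, mul_one,
      smul_mul_assoc, hu2, ← sub_eq_add_neg, sub_nonneg] at h3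
    rwa [Algebra.algebraMap_eq_smul_one]
  · intro h
    rw [← neg_le_iff_add_nonneg]
    calc -offDiagonal X ≤ algebraMap ℝ _ ‖offDiagonal X‖ := by
          rw [neg_le]; exact hW.neg_algebraMap_norm_le_self
      _ ≤ _ := algebraMap_mono _ h

end

end CStarMatrix

/-! ### The cone of `V^♯` over scalar multiples of the unit, and the embedding of `V` in `V^♯`. -/

section ScalarShift

open scoped ComplexOrder MatrixOrder in
lemma invSqrtShift_smul_one {n : Type} [Fintype n] [DecidableEq n] {t ε : ℝ} (h : 0 < ε + t) :
    invSqrtShift ((t : ℂ) • (1 : Matrix n n ℂ)) ε = (((√(ε + t))⁻¹ : ℝ) : ℂ) • 1 := by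
  have hs : CFC.sqrt ((ε : ℂ) • (1 : Matrix n n ℂ) + (t : ℂ) • 1) = ((√(ε + t) : ℝ) : ℂ) • 1 := by
    refine CFC.sqrt_unique ?_ ?_
    · rw [smul_mul_smul_comm, mul_one, ← add_smul, ← Complex.ofReal_mul, Real.mul_self_sqrt h.le,
        Complex.ofReal_add]
    · refine Matrix.PosSemidef.nonneg (Matrix.PosSemidef.one.smul ?_)
      exact_mod_cast Real.sqrt_nonneg _
  rw [invSqrtShift, hs]
  refine Matrix.inv_eq_left_inv ?_
  rw [smul_mul_smul_comm, mul_one, ← Complex.ofReal_mul, inv_mul_cancel₀ (Real.sqrt_pos.2 h).ne',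
    Complex.ofReal_one, one_smul]

lemma scalarCompress_smul_one {V : Type*} [AddCommGroup V] [Module ℂ V] {n : Type} [Fintype n]
    [DecidableEq n] (c : ℂ) (X : Matrix n n V) :
    scalarCompress (c • (1 : Matrix n n ℂ)) X = (c * c) • X := by
  ext i j
  simp [scalarCompress, Matrix.one_apply]

end ScalarShift

section Sharp

variable {V : Type u} [AddCommGroup V] [Module ℂ V] [Star V]

-- Here `A_ε^{-1/2}` is the scalar `(ε + t)^{-1/2}`, so the condition reads `φ X ≥ -(ε + t)`, and `ε
-- → 0`. The case `t = 0` gives the cone of `V`; general `t` gives the order unit norm.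
open scoped ComplexOrder in
lemma MatrixNormOrder.mem_sharpPos_iff_of_fst_eq {S : MatrixNormOrder V} {n : Type} [Fintype n]
    [DecidableEq n] {t : ℝ} (ht : 0 ≤ t) {Z : Matrix n n (Unitization ℂ V)}
    (hZ : (Z.map fun z => z.fst) = (t : ℂ) • 1) :
    Z ∈ S.sharpPos n ↔ (Z.map fun z => z.snd).IsHermitian ∧
      ∀ φ : Matrix n n V →ₗ[ℂ] ℂ, S.IsQuasistate φ → -t ≤ (φ (Z.map fun z => z.snd)).re := by
  have key : ∀ ε : ℝ, 0 < ε → ∀ φ : Matrix n n V →ₗ[ℂ] ℂ,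
      (-1 ≤ (φ (scalarCompress (invSqrtShift (Z.map fun z => z.fst) ε)
        (Z.map fun z => z.snd))).re ↔ -(ε + t) ≤ (φ (Z.map fun z => z.snd)).re) := by
    intro ε hε φ
    have h : 0 < ε + t := by linarith
    rw [hZ, invSqrtShift_smul_one h, scalarCompress_smul_one, map_smul, ← Complex.ofReal_mul,
      ← mul_inv, Real.mul_self_sqrt h.le, smul_eq_mul, Complex.re_ofReal_mul,
      inv_mul_eq_div, le_div_iff₀ h, neg_one_mul]
  constructor
  · rintro ⟨h1, -, h2⟩
    refine ⟨h1, fun φ hφ => le_of_forall_pos_le_add fun ε hε => ?_⟩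
    have := (key ε hε φ).1 (h2 ε hε φ hφ)
    linarith
  · rintro ⟨h1, h2⟩
    refine ⟨h1, ?_, fun ε hε φ hφ => (key ε hε φ).2 ?_⟩
    · rw [hZ]
      refine Matrix.PosSemidef.one.smul ?_
      exact_mod_cast ht
    · have := h2 φ hφ
      linarith

/-- A realization of the matrix norms and matrix cones of `V` inside a unital C⋆-algebra. -/
structure MatrixNormOrder.Realization (S : MatrixNormOrder V) (B : Type*) [CStarAlgebra B]
    [PartialOrder B] [StarOrderedRing B] where
  /-- the embedding -/
  toLinearMap : V →ₗ[ℂ] B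
  injective : Function.Injective toLinearMap
  map_star : ∀ x, toLinearMap (star x) = star (toLinearMap x)
  norm_map : ∀ (n : Type) [Fintype n] [DecidableEq n] (X : Matrix n n V),
    ‖CStarMatrix.ofMatrix (X.map toLinearMap)‖ = S.norm n X
  map_nonneg_iff : ∀ (n : Type) [Fintype n] [DecidableEq n] (X : Matrix n n V),
    0 ≤ CStarMatrix.ofMatrix (X.map toLinearMap) ↔ X ∈ S.pos n

namespace MatrixNormOrder.Realization

variable {S : MatrixNormOrder V} {B : Type*} [CStarAlgebra B] [PartialOrder B] [StarOrderedRing B]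
  (R : S.Realization B)

/-- The entrywise extension of a realization to matrices. -/
noncomputable def matrixMap (n : Type) : Matrix n n V →ₗ[ℂ] CStarMatrix n n B :=
  CStarMatrix.ofMatrixₗ.toLinearMap ∘ₗ R.toLinearMap.mapMatrix

lemma matrixMap_apply {n : Type} (X : Matrix n n V) :
    R.matrixMap n X = CStarMatrix.ofMatrix (X.map R.toLinearMap) := rfl

lemma matrixMap_conjTranspose {n : Type} (X : Matrix n n V) :
    R.matrixMap n X.conjTranspose = star (R.matrixMap n X) := by
  ext i j
  exact R.map_star _

lemma isSelfAdjoint_matrixMap {n : Type} {X : Matrix n n V} (hX : X.IsHermitian) :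
    IsSelfAdjoint (R.matrixMap n X) := by
  rw [IsSelfAdjoint, ← matrixMap_conjTranspose, hX.eq]

lemma isHermitian_of_isSelfAdjoint {n : Type} {X : Matrix n n V}
    (hX : IsSelfAdjoint (R.matrixMap n X)) : X.IsHermitian := by
  rw [IsSelfAdjoint, ← matrixMap_conjTranspose] at hX
  exact Matrix.map_injective R.injective hX

lemma matrixMap_fromBlocks {n : Type} (X : Matrix n n V) :
    R.matrixMap (n ⊕ n) (Matrix.fromBlocks 0 X X.conjTranspose 0) =
      (R.matrixMap n X).offDiagonal := by
  rw [CStarMatrix.offDiagonal, ← matrixMap_conjTranspose]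
  ext i j; rcases i with i | i <;> rcases j with j | j <;> simp [matrixMap_apply]

variable {n : Type} [Fintype n] [DecidableEq n]

open scoped ComplexOrder in
lemma isQuasistate_comp {ψ : CStarMatrix n n B →ₚ[ℂ] ℂ} (h1 : ψ 1 = 1) :
    S.IsQuasistate (ψ.toLinearMap ∘ₗ R.matrixMap n) := by
  refine ⟨fun X => ?_, fun X hX => ?_, fun X => ?_⟩
  · change ψ (R.matrixMap n X.conjTranspose) = star (ψ (R.matrixMap n X))
    rw [matrixMap_conjTranspose, ψ.apply_star]
  · exact (Complex.le_def.1 (ψ.map_nonneg ((R.map_nonneg_iff n X).2 hX))).1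
  · rw [← R.norm_map]
    exact ψ.norm_apply_le_norm h1 _

-- Otherwise some state of `M_n(B)` is negative on the sum, and its restriction to `M_n(V)` is a
-- quasistate violating the bound.
open scoped ComplexOrder in
lemma nonneg_of_forall_isQuasistate {X : Matrix n n V} (hX : X.IsHermitian) {t : ℝ}
    (h : ∀ φ : Matrix n n V →ₗ[ℂ] ℂ, S.IsQuasistate φ → -t ≤ (φ X).re) :
    0 ≤ (t : ℂ) • (1 : CStarMatrix n n B) + R.matrixMap n X := by
  by_contra hn
  have hsa : IsSelfAdjoint ((t : ℂ) • (1 : CStarMatrix n n B) + R.matrixMap n X) := by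
    refine IsSelfAdjoint.add (.smul ?_ (.one _)) (R.isSelfAdjoint_matrixMap hX)
    exact Complex.conj_ofReal t
  obtain ⟨ψ, h1, hneg⟩ := exists_state_re_apply_neg hsa hn
  have := h _ (R.isQuasistate_comp h1)
  change -t ≤ (ψ (R.matrixMap n X)).re at this
  rw [map_add, map_smul, h1, Complex.add_re, smul_eq_mul, mul_one, Complex.ofReal_re] at hneg
  linarith

lemma sharp_mem_pos_map_inr_iff (R : S.Realization B) (X : Matrix n n V) :
    (X.map (Unitization.inr : V → Unitization ℂ V)) ∈ S.sharp.pos n ↔ X ∈ S.pos n := by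
  change X.map (Unitization.inr : V → Unitization ℂ V) ∈ S.sharpPos n ↔ _
  have hfst : ((X.map (Unitization.inr : V → Unitization ℂ V)).map fun z => z.fst) =
      ((0 : ℝ) : ℂ) • (1 : Matrix n n ℂ) := by
    ext i j; simp
  have hsnd : ((X.map (Unitization.inr : V → Unitization ℂ V)).map fun z => z.snd) = X := by
    ext i j; simp
  rw [mem_sharpPos_iff_of_fst_eq le_rfl hfst, hsnd]
  constructor
  · rintro ⟨hX, h⟩
    have := R.nonneg_of_forall_isQuasistate hX h
    rw [Complex.ofReal_zero, zero_smul, zero_add] at this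
    exact (R.map_nonneg_iff n X).1 this
  · intro hX
    have := (R.map_nonneg_iff n X).2 hX
    exact ⟨R.isHermitian_of_isSelfAdjoint (.of_nonneg this), fun φ hφ => by
      rw [neg_zero]; exact hφ.2.1 X hX⟩

lemma sharp_norm_map_inr (R : S.Realization B) (X : Matrix n n V) :
    S.sharp.norm n (X.map (Unitization.inr : V → Unitization ℂ V)) = S.norm n X := by
  set Z := X.map (Unitization.inr : V → Unitization ℂ V) with hZ
  have hW := R.isSelfAdjoint_matrixMap (X := Matrix.fromBlocks 0 X X.conjTranspose 0) (by
    refine R.isHermitian_of_isSelfAdjoint ?_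
    rw [matrixMap_fromBlocks]
    exact CStarMatrix.isSelfAdjoint_offDiagonal _)
  -- An admissible `t` is at least the norm because quasistates detect positivity in `B`;
  -- conversely, quasistates are contractive and the off-diagonal matrix has the norm of `X`.
  have hset : {t : ℝ | 0 ≤ t ∧ Matrix.fromBlocks (sharpScalar n t) Z Z.conjTranspose
      (sharpScalar n t) ∈ S.sharpPos (n ⊕ n)} = Set.Ici (S.norm n X) := by
    ext t
    have hfst : ((Matrix.fromBlocks (sharpScalar n t) Z Z.conjTranspose
        (sharpScalar n t)).map fun z => z.fst) = (t : ℂ) • (1 : Matrix (n ⊕ n) (n ⊕ n) ℂ) := by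
      ext i j
      rcases i with i | i <;> rcases j with j | j <;>
        by_cases h : i = j <;> simp [sharpScalar, hZ, h]
    have hsnd : ((Matrix.fromBlocks (sharpScalar n t) Z Z.conjTranspose
        (sharpScalar n t)).map fun z => z.snd) = Matrix.fromBlocks 0 X X.conjTranspose 0 := by
      ext i j
      rcases i with i | i <;> rcases j with j | j <;>
        simp [sharpScalar, hZ, Matrix.diagonal_apply, apply_ite]
    have hnorm : S.norm n X = ‖R.matrixMap n X‖ := (R.norm_map n X).symm
    rw [Set.mem_ofPred_eq, Set.mem_Ici]
    constructor
    · rintro ⟨ht, h⟩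
      rw [mem_sharpPos_iff_of_fst_eq ht hfst, hsnd] at h
      have := R.nonneg_of_forall_isQuasistate h.1 h.2
      rwa [matrixMap_fromBlocks, CStarMatrix.nonneg_add_offDiagonal_iff _ ht, ← hnorm] at this
    · intro h
      have ht : 0 ≤ t := (norm_nonneg _).trans (hnorm ▸ h)
      refine ⟨ht, ?_⟩
      rw [mem_sharpPos_iff_of_fst_eq ht hfst, hsnd]
      refine ⟨R.isHermitian_of_isSelfAdjoint hW, fun φ hφ => ?_⟩
      have h1 := hφ.2.2 (Matrix.fromBlocks 0 X X.conjTranspose 0)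
      rw [← R.norm_map] at h1
      change _ ≤ ‖R.matrixMap (n ⊕ n) _‖ at h1
      rw [matrixMap_fromBlocks, CStarMatrix.norm_offDiagonal, ← hnorm] at h1
      have h2 := (abs_le.1 (Complex.abs_re_le_norm (φ (Matrix.fromBlocks 0 X X.conjTranspose 0)))).1
      linarith
  change sInf {t : ℝ | 0 ≤ t ∧ _} = _
  rw [hset, csInf_Ici]

end MatrixNormOrder.Realization

end Sharp

/-! ### Closed subalgebras and kernels of positive functionals. -/

section Subalgebra

lemma CStarMatrix.mapₙₐ_injective {A B : Type*} [NonUnitalCStarAlgebra A] [NonUnitalCStarAlgebra B]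
    {n : Type*} [Fintype n] (f : A →⋆ₙₐ[ℂ] B) (hf : Function.Injective f) :
    Function.Injective (CStarMatrix.mapₙₐ (n := n) f) :=
  CStarMatrix.map_injective hf

/-- If `V` embeds completely isometrically and completely order isomorphically into a C⋆-algebra,
with range a closed subalgebra, then `V` is isomorphic to a C⋆-algebra. -/
lemma MatrixNormOrder.isIsomorphicToCStarAlgebra_of_range {V : Type u} [AddCommGroup V] [Module ℂ V]
    [Star V] {S : MatrixNormOrder V} {C : Type u} [NonUnitalCStarAlgebra C] [PartialOrder C]
    [StarOrderedRing C] (T : V →ₗ[ℂ] C) (hT : Function.Injective T)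
    (hstar : ∀ x, T (star x) = star (T x))
    (hnorm : ∀ (n : Type) [Fintype n] [DecidableEq n] (X : Matrix n n V),
      ‖CStarMatrix.ofMatrix (X.map T)‖ = S.norm n X)
    (hpos : ∀ (n : Type) [Fintype n] [DecidableEq n] (X : Matrix n n V),
      0 ≤ CStarMatrix.ofMatrix (X.map T) ↔ X ∈ S.pos n)
    (hclosed : IsClosed (Set.range T)) (hmul : ∀ x y, T x * T y ∈ Set.range T) :
    S.IsIsomorphicToCStarAlgebra := by
  let A : NonUnitalStarSubalgebra ℂ C :=
    { carrier := Set.range T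
      add_mem' := by rintro _ _ ⟨x, rfl⟩ ⟨y, rfl⟩; exact ⟨x + y, map_add T x y⟩
      zero_mem' := ⟨0, map_zero T⟩
      mul_mem' := by rintro _ _ ⟨x, rfl⟩ ⟨y, rfl⟩; exact hmul x y
      smul_mem' := by rintro c _ ⟨x, rfl⟩; exact ⟨c • x, map_smul T c x⟩
      star_mem' := by rintro _ ⟨x, rfl⟩; exact ⟨star x, hstar x⟩ }
  have : IsClosed (A : Set C) := hclosed
  let : PartialOrder A := CStarAlgebra.spectralOrder A
  have : StarOrderedRing A := CStarAlgebra.spectralOrderedRing A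
  let T' : V →ₗ[ℂ] A :=
    { toFun := fun x => ⟨T x, x, rfl⟩
      map_add' := fun x y => Subtype.ext (map_add T x y)
      map_smul' := fun c x => Subtype.ext (map_smul T c x) }
  have hT' : Function.Bijective T' :=
    ⟨fun x y h => hT (congrArg Subtype.val h), by rintro ⟨_, x, rfl⟩; exact ⟨x, rfl⟩⟩
  let ι : A →⋆ₙₐ[ℂ] C := NonUnitalStarSubalgebraClass.subtype A
  have hι : Function.Injective ι := Subtype.val_injective
  refine ⟨A, inferInstance, inferInstance, inferInstance, ⟨⟨LinearEquiv.ofBijective T' hT',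
    fun x => Subtype.ext (hstar x), fun n _ _ X => ?_, fun n _ _ X => ?_⟩⟩⟩
  · rw [← hnorm]
    exact (NonUnitalStarAlgHom.norm_map (CStarMatrix.mapₙₐ ι)
      (CStarMatrix.mapₙₐ_injective ι hι) (CStarMatrix.ofMatrix (X.map T'))).symm
  · rw [← hpos]
    exact (NonUnitalStarAlgHom.map_nonneg_iff (CStarMatrix.mapₙₐ ι)
      (CStarMatrix.mapₙₐ_injective ι hι) (a := CStarMatrix.ofMatrix (X.map T'))).symm

-- Cauchy-Schwarz with `r = h^{1/2}`: `χ (h y) = ⟨r, r y⟩`, and `r` has GNS seminorm zero.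
open scoped ComplexOrder in
lemma PositiveLinearMap.apply_mul_eq_zero {C : Type*} [NonUnitalCStarAlgebra C] [PartialOrder C]
    [StarOrderedRing C] (χ : C →ₚ[ℂ] ℂ) {h : C} (hh : 0 ≤ h) (h0 : χ h = 0) (y : C) :
    χ (h * y) = 0 := by
  set r := CFC.sqrt h with hr
  have hrs : star r = r := (IsSelfAdjoint.of_nonneg (CFC.sqrt_nonneg h)).star_eq
  have hrr : r * r = h := CFC.sqrt_mul_sqrt_self h
  have h1 : ‖χ.toPreGNS r‖ = 0 := by
    rw [χ.preGNS_norm_def]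
    simp [hrs, hrr, h0]
  have h2 := norm_inner_le_norm (𝕜 := ℂ) (χ.toPreGNS r) (χ.toPreGNS (r * y))
  rw [h1, zero_mul, χ.preGNS_inner_def] at h2
  simp only [ofPreGNS_toPreGNS, hrs, ← mul_assoc, hrr] at h2
  exact norm_le_zero_iff.1 h2

namespace CStarMatrix

variable {C : Type*} [NonUnitalCStarAlgebra C] [PartialOrder C] [StarOrderedRing C]

lemma norm_const_unit (c : C) :
    ‖(ofMatrix (Matrix.of fun _ _ => c) : CStarMatrix Unit Unit C)‖ = ‖c‖ :=
  NonUnitalStarAlgHom.norm_map (toOneByOne Unit ℂ C) (toOneByOne Unit ℂ C).injective c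

lemma const_unit_nonneg_iff {c : C} :
    0 ≤ (ofMatrix (Matrix.of fun _ _ => c) : CStarMatrix Unit Unit C) ↔ 0 ≤ c :=
  NonUnitalStarAlgHom.map_nonneg_iff (toOneByOne Unit ℂ C) (toOneByOne Unit ℂ C).injective (a := c)

end CStarMatrix

end Subalgebra

/-! ### From `E^♯` to `E`. -/

section OperatorSystem

variable {H : Type u} [NormedAddCommGroup H] [InnerProductSpace ℂ H] [CompleteSpace H]

/-- An operator system is realized in `B(H)`. -/
noncomputable def OperatorSystem.realization (E : OperatorSystem H) :
    E.matrixNormOrder.Realization (H →L[ℂ] H) where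
  toLinearMap :=
    { toFun := Subtype.val
      map_add' := fun _ _ => rfl
      map_smul' := fun _ _ => rfl }
  injective := Subtype.val_injective
  map_star _ := rfl
  norm_map _ _ _ _ := rfl
  map_nonneg_iff _ _ _ _ := Iff.rfl

open scoped ComplexOrder in
lemma OperatorSystem.isIsomorphicToCStarAlgebra_of_sharp (E : OperatorSystem H)
    {ι : Type v} (M : ι → Type w) [∀ i, NonUnitalCStarAlgebra (M i)]
    [∀ i, PartialOrder (M i)] [∀ i, StarOrderedRing (M i)]
    (ρ : ∀ i, M i →ₗ[ℂ] E)
    (hρ : ∀ (i : ι) (a : M i), 0 ≤ a → 0 ≤ (ρ i a : H →L[ℂ] H))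
    (hE : (E : Set (H →L[ℂ] H)) =
      closure (⋃ i, Set.range fun a : M i => (ρ i a : H →L[ℂ] H)))
    (h : E.matrixNormOrder.sharp.IsIsomorphicToCStarAlgebra) :
    E.matrixNormOrder.IsIsomorphicToCStarAlgebra := by
  obtain ⟨C, _, _, _, ⟨f⟩⟩ := h
  let T : E →ₗ[ℂ] C := f.toLinearEquiv.toLinearMap ∘ₗ Unitization.inrHom ℂ ℂ E
  have hT : ∀ x, T x = f.toLinearEquiv (Unitization.inr x) := fun _ => rfl
  have hTinj : Function.Injective T := f.toLinearEquiv.injective.comp Unitization.inr_injective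
  have hstar : ∀ x, T (star x) = star (T x) := fun x => by
    rw [hT, hT, Unitization.inr_star, f.map_star]
  have hnorm : ∀ (n : Type) [Fintype n] [DecidableEq n] (X : Matrix n n E),
      ‖CStarMatrix.ofMatrix (X.map T)‖ = E.matrixNormOrder.norm n X := fun n _ _ X => by
    rw [← E.realization.sharp_norm_map_inr X, ← f.norm_map]
    rfl
  have hpos : ∀ (n : Type) [Fintype n] [DecidableEq n] (X : Matrix n n E),
      0 ≤ CStarMatrix.ofMatrix (X.map T) ↔ X ∈ E.matrixNormOrder.pos n := fun n _ _ X => by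
    rw [← E.realization.sharp_mem_pos_map_inr_iff X, ← f.map_mem_pos_iff]
    rfl
  have hnorm1 : ∀ x : E, ‖T x‖ = ‖(x : H →L[ℂ] H)‖ := fun x => by
    rw [← CStarMatrix.norm_const_unit, ← CStarMatrix.norm_const_unit (x : H →L[ℂ] H)]
    exact hnorm Unit (Matrix.of fun _ _ => x)
  have hpos1 : ∀ x : E, 0 ≤ (x : H →L[ℂ] H) → 0 ≤ T x := fun x hx => by
    rw [← CStarMatrix.const_unit_nonneg_iff] at hx ⊢
    exact (hpos Unit (Matrix.of fun _ _ => x)).2 hx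
  have hTiso : Isometry T := AddMonoidHomClass.isometry_of_norm T hnorm1
  have : CompleteSpace E := E.isClosed'.completeSpace_coe
  -- The scalar coordinate of `E^♯`, carried to `C`. It is positive because positive elements of
  -- `E^♯` have positive scalar part.
  let χ₀ : C →ₗ[ℂ] ℂ :=
    { toFun := fun c => (f.toLinearEquiv.symm c).fst
      map_add' := fun x y => by simp
      map_smul' := fun c x => by simp }
  have hχ₀ : ∀ c, 0 ≤ c → 0 ≤ χ₀ c := fun c hc => by
    have h1 := (f.map_mem_pos_iff Unit (Matrix.of fun _ _ => f.toLinearEquiv.symm c)).1 (by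
      have hm : (Matrix.of fun _ _ => f.toLinearEquiv.symm c : Matrix Unit Unit _).map
          f.toLinearEquiv = Matrix.of fun _ _ => c := by
        ext i j
        exact f.toLinearEquiv.apply_symm_apply c
      rw [hm]
      exact CStarMatrix.const_unit_nonneg_iff.2 hc)
    have h2 : Matrix.PosSemidef _ := h1.2.1
    exact h2.diag_nonneg (i := ())
  let χ : C →ₚ[ℂ] ℂ := .mk₀ χ₀ hχ₀
  have hχT : ∀ x, χ (T x) = 0 := fun x => by
    change (f.toLinearEquiv.symm (f.toLinearEquiv (Unitization.inr x))).fst = 0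
    simp
  have hχ : ∀ c, χ c = 0 → c ∈ Set.range T := fun c hc => by
    refine ⟨(f.toLinearEquiv.symm c).snd, ?_⟩
    rw [hT, ← LinearEquiv.eq_symm_apply]
    exact Unitization.ext hc.symm rfl
  refine MatrixNormOrder.isIsomorphicToCStarAlgebra_of_range T hTinj hstar hnorm hpos
    hTiso.isClosedEmbedding.isClosed_range fun x y => hχ _ ?_
  -- With `y` fixed, the vanishing of `χ (T z * T y)` is a closed condition on `z`, so it suffices
  -- to test it on the ranges of the `ρ i`.
  have hclosed : IsClosed {z : E | χ (T z * T y) = 0} := by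
    refine isClosed_eq ?_ continuous_const
    exact (map_continuous χ).comp (hTiso.continuous.mul continuous_const)
  have hsub : (⋃ i, Set.range (ρ i)) ⊆ {z : E | χ (T z * T y) = 0} := by
    refine Set.iUnion_subset fun i => ?_
    rintro _ ⟨a, rfl⟩
    -- Each `a` is a combination of four positive elements, which `T ∘ ρ i` sends to positive
    -- elements of the kernel of `χ`.
    obtain ⟨b, hb, -, hab⟩ := CStarAlgebra.exists_sum_four_nonneg a
    rw [Set.mem_ofPred_eq, hab]
    simp only [map_sum, map_smul, Finset.sum_mul, smul_mul_assoc]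
    refine Finset.sum_eq_zero fun k _ => ?_
    rw [χ.apply_mul_eq_zero (hpos1 _ (hρ i _ (hb k))) (hχT _), smul_zero]
  -- The closure in `hE` is taken in `B(H)`; here it is transferred to the subspace topology of `E`.
  have hx : x ∈ closure (⋃ i, Set.range (ρ i)) := by
    rw [Topology.IsInducing.subtypeVal.closure_eq_preimage_closure_image, Set.mem_preimage,
      Set.image_iUnion]
    have : (x : H →L[ℂ] H) ∈ (E : Set (H →L[ℂ] H)) := x.2
    rw [hE] at this
    convert! this using 4
    ext; simp
  exact hclosed.closure_subset_iff.2 hsub hx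

end OperatorSystem

/-! ### From `E` to `E^♯`: comparison with the C⋆-unitization. -/

section InvSqrtShift

-- The witness is `s = A_ε^{1/2}`, invertible because `ε 1 + A` is positive definite. Conjugation by
-- `s` undoes conjugation by `invSqrtShift`.
open scoped ComplexOrder MatrixOrder in
lemma invSqrtShift_spec {n : Type} [Fintype n] [DecidableEq n] {a : Matrix n n ℂ}
    (ha : a.PosSemidef) {ε : ℝ} (hε : 0 < ε) :
    ∃ s : Matrix n n ℂ, s.IsHermitian ∧ (invSqrtShift a ε).IsHermitian ∧
      s * s = (ε : ℂ) • 1 + a ∧ s * invSqrtShift a ε = 1 ∧ invSqrtShift a ε * s = 1 := by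
  have hpd : ((ε : ℂ) • (1 : Matrix n n ℂ) + a).PosDef := by
    refine Matrix.PosDef.add_posSemidef (Matrix.PosDef.one.smul ?_) ha
    exact_mod_cast hε
  set s := CFC.sqrt ((ε : ℂ) • (1 : Matrix n n ℂ) + a) with hs
  have hss : s * s = (ε : ℂ) • 1 + a :=
    CFC.sqrt_mul_sqrt_self _ hpd.posSemidef.nonneg
  have hsa : s.IsHermitian := (Matrix.nonneg_iff_posSemidef.1 (CFC.sqrt_nonneg _)).isHermitian
  have hu : IsUnit s.det := by
    have h1 : IsUnit ((ε : ℂ) • (1 : Matrix n n ℂ) + a).det :=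
      (Matrix.isUnit_iff_isUnit_det _).1 hpd.isUnit
    rw [← hss, Matrix.det_mul] at h1
    exact isUnit_of_mul_isUnit_left h1
  exact ⟨s, hsa, hsa.inv, hss, Matrix.mul_nonsing_inv s hu, Matrix.nonsing_inv_mul s hu⟩

end InvSqrtShift

namespace MatrixNormOrder.Iso

variable {V : Type u} [AddCommGroup V] [Module ℂ V] [Star V] {S : MatrixNormOrder V}
  {A : Type u} [NonUnitalCStarAlgebra A] [PartialOrder A] [StarOrderedRing A]
  [PartialOrder (Unitization ℂ A)] [StarOrderedRing (Unitization ℂ A)]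
  (g : S.Iso (cstarMatrixNormOrder A))

/-- The realization in the C⋆-algebraic unitization of `A` given by an isomorphism with `A`. -/
noncomputable def realization : S.Realization (Unitization ℂ A) where
  toLinearMap := Unitization.inrHom ℂ ℂ A ∘ₗ g.toLinearEquiv.toLinearMap
  injective := Unitization.inr_injective.comp g.toLinearEquiv.injective
  map_star x :=
    (congrArg Unitization.inr (g.map_star x)).trans (Unitization.inr_star _)
  norm_map n _ _ X := by
    rw [← g.norm_map]
    exact NonUnitalStarAlgHom.norm_map
      (CStarMatrix.mapₙₐ (Unitization.inrNonUnitalStarAlgHom ℂ A))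
      (CStarMatrix.mapₙₐ_injective _ Unitization.inr_injective)
      (CStarMatrix.ofMatrix (X.map g.toLinearEquiv))
  map_nonneg_iff n _ _ X := by
    rw [← g.map_mem_pos_iff]
    exact NonUnitalStarAlgHom.map_nonneg_iff
      (CStarMatrix.mapₙₐ (Unitization.inrNonUnitalStarAlgHom ℂ A))
      (CStarMatrix.mapₙₐ_injective _ Unitization.inr_injective)
      (a := CStarMatrix.ofMatrix (X.map g.toLinearEquiv))

variable {n : Type} [Fintype n] [DecidableEq n]

/-- No extension of `φ` to the unitization is needed: in `M_n(A)` the image of `X` is `p - m` with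
`p, m ≥ 0` and `‖m‖ ≤ 1`, so positivity on `p` and contractivity on `m` suffice. -/
lemma neg_one_le_quasistate {φ : Matrix n n V →ₗ[ℂ] ℂ} (hφ : S.IsQuasistate φ) {X : Matrix n n V}
    (h : 0 ≤ g.realization.matrixMap n X + 1) : -1 ≤ (φ X).re := by
  let J : CStarMatrix n n A →⋆ₙₐ[ℂ] CStarMatrix n n (Unitization ℂ A) :=
    CStarMatrix.mapₙₐ (Unitization.inrNonUnitalStarAlgHom ℂ A)
  have hJ : Function.Injective J := CStarMatrix.mapₙₐ_injective _ Unitization.inr_injective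
  let y : CStarMatrix n n A := CStarMatrix.ofMatrix (X.map g.toLinearEquiv)
  have hJy : J y = g.realization.matrixMap n X := rfl
  obtain ⟨p, m, hp, -, hm1, hy⟩ := exists_eq_sub_of_nonneg_add_one J hJ (y := y) (by rwa [hJy])
  let σ : CStarMatrix n n A → Matrix n n V := fun c =>
    (CStarMatrix.ofMatrix.symm c).map g.toLinearEquiv.symm
  have hσ : ∀ c, CStarMatrix.ofMatrix ((σ c).map g.toLinearEquiv) = c := fun c => by
    ext i j; exact g.toLinearEquiv.apply_symm_apply _
  have hX : X = σ p - σ m := by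
    refine Matrix.map_injective g.toLinearEquiv.injective (CStarMatrix.ofMatrix.injective ?_)
    change y = CStarMatrix.ofMatrix ((σ p - σ m).map g.toLinearEquiv)
    rw [Matrix.map_sub _ (map_sub g.toLinearEquiv), ← CStarMatrix.of_sub_of, hσ, hσ,
      hy]
  have h1 : 0 ≤ (φ (σ p)).re := by
    refine hφ.2.1 _ ((g.map_mem_pos_iff n _).1 ?_)
    change 0 ≤ CStarMatrix.ofMatrix ((σ p).map g.toLinearEquiv)
    rw [hσ]; exact hp
  have h2 : ‖φ (σ m)‖ ≤ 1 := by
    refine (hφ.2.2 _).trans ?_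
    rw [← g.norm_map]
    change ‖CStarMatrix.ofMatrix _‖ ≤ 1
    rwa [hσ]
  have h3 := (Complex.re_le_norm (φ (σ m))).trans h2
  rw [hX, map_sub, Complex.sub_re]
  linarith

/-- The extension of an isomorphism to the unitizations. -/
noncomputable def unitizationEquiv : Unitization ℂ V ≃ₗ[ℂ] Unitization ℂ A where
  toFun z := ⟨z.fst, g.toLinearEquiv z.snd⟩
  invFun z := ⟨z.fst, g.toLinearEquiv.symm z.snd⟩
  map_add' x y := Unitization.ext rfl (map_add g.toLinearEquiv x.snd y.snd)
  map_smul' c x := Unitization.ext rfl (map_smul g.toLinearEquiv c x.snd)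
  left_inv x := Unitization.ext rfl (g.toLinearEquiv.symm_apply_apply x.snd)
  right_inv x := Unitization.ext rfl (g.toLinearEquiv.apply_symm_apply x.snd)

end MatrixNormOrder.Iso

section ScalarMatrix

variable {A : Type*} [NonUnitalCStarAlgebra A] {n : Type*}

/-- Scalar matrices as matrices over the unitization. -/
noncomputable def scalarMatrix (a : Matrix n n ℂ) : CStarMatrix n n (Unitization ℂ A) :=
  CStarMatrix.ofMatrix (a.map Unitization.inl)

lemma scalarMatrix_add (a b : Matrix n n ℂ) :
    scalarMatrix (A := A) (a + b) = scalarMatrix a + scalarMatrix b := by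
  ext i j <;> simp [scalarMatrix]

lemma star_scalarMatrix {a : Matrix n n ℂ} (ha : a.IsHermitian) :
    star (scalarMatrix (A := A) a) = scalarMatrix a := by
  conv_rhs => rw [← ha.eq]
  ext i j <;> simp [scalarMatrix, CStarMatrix.star_apply]

lemma scalarMatrix_smul_one [DecidableEq n] (c : ℂ) :
    scalarMatrix (A := A) (c • (1 : Matrix n n ℂ)) = c • 1 := by
  ext i j <;> by_cases h : i = j <;> simp [scalarMatrix, h]

variable [Fintype n]

lemma scalarMatrix_mul (a b : Matrix n n ℂ) :
    scalarMatrix (A := A) (a * b) = scalarMatrix a * scalarMatrix b :=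
  congrArg CStarMatrix.ofMatrix (Matrix.map_mul (f := Unitization.inlRingHom ℂ A))

end ScalarMatrix

lemma CStarAlgebra.exists_eq_star_mul_self {D : Type*} [NonUnitalCStarAlgebra D] [PartialOrder D]
    [StarOrderedRing D] {a : D} (ha : 0 ≤ a) : ∃ b, a = star b * b :=
  CStarAlgebra.nonneg_iff_eq_star_mul_self.1 ha

-- The scalar part is a star-homomorphism to `ℂ`; applied entrywise to `N = P⋆ P` it gives a matrix
-- of the same form.
open scoped ComplexOrder in
lemma CStarMatrix.posSemidef_fst_of_nonneg {A : Type*} [NonUnitalCStarAlgebra A]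
    [PartialOrder (Unitization ℂ A)] [StarOrderedRing (Unitization ℂ A)] {n : Type*} [Fintype n]
    {N : CStarMatrix n n (Unitization ℂ A)} (hN : 0 ≤ N) :
    ((CStarMatrix.ofMatrix.symm N).map fun z => z.fst).PosSemidef := by
  obtain ⟨P, rfl⟩ := CStarAlgebra.exists_eq_star_mul_self hN
  convert Matrix.posSemidef_conjTranspose_mul_self ((CStarMatrix.ofMatrix.symm P).map fun z => z.fst)
    using 1
  ext i j
  change Unitization.fstHom ℂ A _ = _
  simp [CStarMatrix.mul_apply, Matrix.mul_apply, CStarMatrix.star_apply]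

lemma CStarAlgebra.nonneg_of_forall_pos_smul_one_add {B : Type*} [CStarAlgebra B] [PartialOrder B]
    [StarOrderedRing B] {b : B} (h : ∀ ε : ℝ, 0 < ε → 0 ≤ (ε : ℂ) • (1 : B) + b) : 0 ≤ b := by
  have hc : Continuous fun ε : ℝ => (ε : ℂ) • (1 : B) + b := by fun_prop
  have ht : Filter.Tendsto (fun ε : ℝ => (ε : ℂ) • (1 : B) + b) (nhdsWithin 0 (Set.Ioi 0))
      (nhds b) := by
    have := (hc.tendsto 0).mono_left (nhdsWithin_le_nhds (s := Set.Ioi 0))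
    simpa using this
  exact CStarAlgebra.isClosed_nonneg.mem_of_tendsto ht
    (Filter.eventually_of_mem self_mem_nhdsWithin h)

namespace MatrixNormOrder.Iso

variable {V : Type u} [AddCommGroup V] [Module ℂ V] [Star V] {S : MatrixNormOrder V}
  {A : Type u} [NonUnitalCStarAlgebra A] [PartialOrder A] [StarOrderedRing A]
  [PartialOrder (Unitization ℂ A)] [StarOrderedRing (Unitization ℂ A)]
  (g : S.Iso (cstarMatrixNormOrder A))

variable {n : Type}

lemma ofMatrix_map_unitizationEquiv (Z : Matrix n n (Unitization ℂ V)) :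
    CStarMatrix.ofMatrix (Z.map g.unitizationEquiv) =
      scalarMatrix (Z.map fun z => z.fst) + g.realization.matrixMap n (Z.map fun z => z.snd) := by
  ext i j
  · exact (add_zero (Z i j).fst).symm
  · exact (zero_add (g.toLinearEquiv (Z i j).snd)).symm

variable [Fintype n] [DecidableEq n]

lemma matrixMap_scalarCompress {n : Type} [Fintype n] (b : Matrix n n ℂ) (X : Matrix n n V) :
    g.realization.matrixMap n (scalarCompress b X) =
      scalarMatrix b * g.realization.matrixMap n X * scalarMatrix b := by
  have hterm : ∀ (c d : ℂ) (v : V), g.realization.toLinearMap ((c * d) • v) =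
      Unitization.inl c * g.realization.toLinearMap v * Unitization.inl d := fun c d v => by
    rw [map_smul]
    change _ • Unitization.inr (g.toLinearEquiv v) =
      Unitization.inl c * Unitization.inr (g.toLinearEquiv v) * Unitization.inl d
    ext <;> simp [mul_smul, smul_comm c d]
  refine CStarMatrix.ext fun i j => ?_
  change g.realization.toLinearMap (∑ k, ∑ l, (b i k * b l j) • X k l) = _
  simp only [map_sum, hterm, CStarMatrix.mul_apply, Finset.sum_mul]
  exact Finset.sum_comm

open scoped ComplexOrder in
lemma nonneg_map_unitizationEquiv_iff (Z : Matrix n n (Unitization ℂ V)) :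
    0 ≤ CStarMatrix.ofMatrix (Z.map g.unitizationEquiv) ↔ Z ∈ S.sharpPos n := by
  set N := CStarMatrix.ofMatrix (Z.map g.unitizationEquiv) with hN
  set X := Z.map fun z => z.snd with hX
  set a := Z.map fun z => z.fst with ha
  have hdecomp : N = scalarMatrix a + g.realization.matrixMap n X :=
    g.ofMatrix_map_unitizationEquiv Z
  have hshift : ∀ ε : ℝ, (ε : ℂ) • 1 + N =
      scalarMatrix ((ε : ℂ) • 1 + a) + g.realization.matrixMap n X := fun ε => by
    rw [hdecomp, scalarMatrix_add, scalarMatrix_smul_one, add_assoc]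
  have hone : scalarMatrix (A := A) (1 : Matrix n n ℂ) = 1 := by
    simpa using scalarMatrix_smul_one (A := A) (n := n) 1
  constructor
  · intro h
    have haP := CStarMatrix.posSemidef_fst_of_nonneg h
    change a.PosSemidef at haP
    have hXh : X.IsHermitian := by
      refine g.realization.isHermitian_of_isSelfAdjoint ?_
      have h1 := (IsSelfAdjoint.of_nonneg h).sub (star_scalarMatrix (A := A) haP.isHermitian)
      rwa [hdecomp, add_sub_cancel_left] at h1
    refine ⟨hXh, haP, fun ε hε φ hφ => g.neg_one_le_quasistate hφ ?_⟩
    obtain ⟨s, -, hb, hss, hsb, hbs⟩ := invSqrtShift_spec (a := a) haP hε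
    have h1 : 0 ≤ (ε : ℂ) • 1 + N :=
      add_nonneg (nonneg_smul_of_nonneg zero_le_one hε.le) h
    -- This conjugation turns `ε + N` into `1 + A_ε^{-1/2} X A_ε^{-1/2}`.
    have h2 := star_left_conjugate_nonneg h1 (scalarMatrix (invSqrtShift a ε))
    rwa [star_scalarMatrix hb, hshift, mul_add, add_mul, ← scalarMatrix_mul, ← scalarMatrix_mul,
      ← hss, ← mul_assoc, hbs, one_mul, hsb, hone, ← matrixMap_scalarCompress, add_comm] at h2
  · rintro ⟨hXh, haP, h⟩
    refine CStarAlgebra.nonneg_of_forall_pos_smul_one_add fun ε hε => ?_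
    obtain ⟨s, hs, hb, hss, hsb, hbs⟩ := invSqrtShift_spec (a := a) haP hε
    have hXb : (scalarCompress (invSqrtShift a ε) X).IsHermitian := by
      refine g.realization.isHermitian_of_isSelfAdjoint ?_
      rw [matrixMap_scalarCompress]
      have h1 := (g.realization.isSelfAdjoint_matrixMap hXh).conjugate
        (scalarMatrix (A := A) (invSqrtShift a ε))
      rwa [star_scalarMatrix hb] at h1
    have h1 := g.realization.nonneg_of_forall_isQuasistate hXb (h ε hε)
    -- Conjugating back by `A_ε^{1/2}` recovers `ε + N`.
    have h2 := star_left_conjugate_nonneg h1 (scalarMatrix (A := A) s)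
    rw [hshift, ← hss]
    rw [star_scalarMatrix hs, matrixMap_scalarCompress, mul_add, add_mul, Complex.ofReal_one,
      one_smul, mul_one, ← scalarMatrix_mul] at h2
    have e : scalarMatrix s * (scalarMatrix (invSqrtShift a ε) * g.realization.matrixMap n X *
        scalarMatrix (invSqrtShift a ε)) * scalarMatrix s = g.realization.matrixMap n X := by
      simp only [mul_assoc]
      rw [← scalarMatrix_mul, hbs, hone, mul_one, ← mul_assoc, ← scalarMatrix_mul, hsb, hone,
        one_mul]
    rwa [e] at h2

lemma norm_map_unitizationEquiv (Z : Matrix n n (Unitization ℂ V)) :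
    ‖CStarMatrix.ofMatrix (Z.map g.unitizationEquiv)‖ = S.sharp.norm n Z := by
  set N := CStarMatrix.ofMatrix (Z.map g.unitizationEquiv) with hN
  have hstar : ∀ z, g.unitizationEquiv (star z) = star (g.unitizationEquiv z) := fun z =>
    Unitization.ext rfl (g.map_star z.snd)
  -- The block matrix corresponds to `t 1` plus the off-diagonal matrix of `N`, whose positivity
  -- means `‖N‖ ≤ t`.
  have hset : {t : ℝ | 0 ≤ t ∧ Matrix.fromBlocks (sharpScalar n t) Z Z.conjTranspose
      (sharpScalar n t) ∈ S.sharpPos (n ⊕ n)} = Set.Ici ‖N‖ := by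
    ext t
    have hblock : CStarMatrix.ofMatrix ((Matrix.fromBlocks (sharpScalar n t) Z Z.conjTranspose
        (sharpScalar n t)).map g.unitizationEquiv) = (t : ℂ) • 1 + N.offDiagonal := by
      have hinl : g.unitizationEquiv (Unitization.inl (t : ℂ)) = Unitization.inl (t : ℂ) :=
        Unitization.ext rfl (map_zero g.toLinearEquiv)
      have hinl' : (Unitization.inl (t : ℂ) : Unitization ℂ A) = (t : ℂ) • 1 := by
        ext <;> simp
      refine CStarMatrix.ext fun i j => ?_
      rcases i with i | i <;> rcases j with j | j <;>
        by_cases h : i = j <;>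
        simp [-Complex.coe_smul, CStarMatrix.offDiagonal, sharpScalar, h,
          hinl, hinl', hN, CStarMatrix.star_apply, hstar]
    rw [Set.mem_ofPred_eq, Set.mem_Ici, ← g.nonneg_map_unitizationEquiv_iff, hblock]
    constructor
    · rintro ⟨ht, h⟩
      exact (CStarMatrix.nonneg_add_offDiagonal_iff N ht).1 h
    · intro h
      have ht : 0 ≤ t := (norm_nonneg _).trans h
      exact ⟨ht, (CStarMatrix.nonneg_add_offDiagonal_iff N ht).2 h⟩
  change _ = sInf {t : ℝ | 0 ≤ t ∧ _}
  rw [hset, csInf_Ici]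

end MatrixNormOrder.Iso

lemma MatrixNormOrder.IsIsomorphicToCStarAlgebra.sharp {V : Type u} [AddCommGroup V] [Module ℂ V]
    [Star V] {S : MatrixNormOrder V} (h : S.IsIsomorphicToCStarAlgebra) :
    S.sharp.IsIsomorphicToCStarAlgebra := by
  obtain ⟨A, _, _, _, ⟨g⟩⟩ := h
  let : PartialOrder (Unitization ℂ A) := CStarAlgebra.spectralOrder _
  have : StarOrderedRing (Unitization ℂ A) := CStarAlgebra.spectralOrderedRing _
  exact ⟨Unitization ℂ A, inferInstance, inferInstance, inferInstance,
    ⟨⟨g.unitizationEquiv, fun z => Unitization.ext rfl (g.map_star z.snd),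
      fun n _ _ Z => g.norm_map_unitizationEquiv Z,
      fun n _ _ Z => g.nonneg_map_unitizationEquiv_iff Z⟩⟩⟩

theorem corollaryB {H : Type u} [NormedAddCommGroup H] [InnerProductSpace ℂ H] [CompleteSpace H]
    (E : OperatorSystem H)
    {ι : Type v} (M : ι → Type w) [∀ i, NonUnitalCStarAlgebra (M i)]
    [∀ i, PartialOrder (M i)] [∀ i, StarOrderedRing (M i)]
    (ρ : ∀ i, M i →ₗ[ℂ] E)
    (hρ : ∀ (i : ι) (a : M i), 0 ≤ a → 0 ≤ (ρ i a : H →L[ℂ] H))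
    (hE : (E : Set (H →L[ℂ] H)) =
      closure (⋃ i, Set.range fun a : M i => (ρ i a : H →L[ℂ] H))) :
    E.matrixNormOrder.IsIsomorphicToCStarAlgebra ↔
      E.matrixNormOrder.sharp.IsIsomorphicToCStarAlgebra :=
  ⟨fun h => h.sharp, fun h => E.isIsomorphicToCStarAlgebra_of_sharp M ρ hρ hE h⟩
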